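/- \textbf{Setting.} Fix $\bar b,L,\bar c>0$. Let $\mathcal U_c$ be the set of functions $u:[0,\bar b]\to\mathbb R$ that are monotonically increasing, concave and Lipschitz with modulus at most $L$, with $u(0)=0$, $u(\bar b)=1$. Let $u^*\in\mathcal U_c$ and $\sigma^*\ge 1/\bar c$. Let $(W_k,Y_k)$, $k=1,\dots,K$ $(K\ge1)$, be pairs of discrete random variables with finite support in $[0,\bar b]$ (lotteries), and let $\varepsilon_{k,1},\varepsilon_{k,2}$, $k=1,\dots,K$, be i.i.d. $\mathrm{Gumbel}(0,\sigma^*)$, i.e. with distribution function $x\mapsto e^{-e^{-x/\sigma^*}}$. The observed choices are $Z_k=1$ if $\mathbb E[u^*(W_k)]+\varepsilon_{k,1}\ge \mathbb E[u^*(Y_k)]+\varepsilon_{k,2}$, and $Z_k=-1$ otherwise. Let $0=y_1<\dots<y_N=\bar b$ enumerate the set of breakpoints $\{0\}\cup\bigcup_k\operatorname{supp}(W_k)\cup\bigcup_k\operatorname{supp}(Y_k)\cup\{\bar b\}$, and let $\mu_N:=\max_{2\le j\le N}(y_j-y_{j-1})$, $p^k_j:=\mathbb P[W_k=y_j]-\mathbb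 P[Y_k=y_j]$. Let $P\in\mathbb R^{K\times(N-1)}$ be the matrix with rows $(p^k_2,\dots,p^k_N)$, and put $\Sigma_D:=\frac1K P^\top P$, $R_D:=\operatorname{rank}\Sigma_D$, $\omega:=\frac1{2+2e^{2\bar c}}$. \textbf{Estimator.} Let $(\bar\alpha,\bar\beta,\gamma)\in\mathbb R^N\times\mathbb R^{N-1}\times[0,\bar c]$ be an optimal solution of the program of maximizing $-\sum_{k=1}^K\log\bigl[1+\exp\bigl(-\sum_{j=1}^N Z_kp^k_j\bar\alpha_j\bigr)\bigr]$ subject to $\bar\beta_j=(\bar\alpha_{j+1}-\bar\alpha_j)/(y_{j+1}-y_j)$ for $1\le j\le N-1$, $\bar\beta_{j+1}\le\bar\beta_j$ for $1\le j\le N-2$, $\bar\beta_1\le L\gamma$, $\bar\beta_{N-1}\ge0$, $\bar\alpha_1=0$, $\bar\alpha_N=\gamma$. If $\gamma>0$, put $\hat\sigma_{\rm MLE}:=1/\gamma$ and let $\hat u_{\rm MLE}$ be the piecewise linear function on $[0,\bar b]$ with $\hat u_{\rm MLE}(0)=0$, $\hat u_{\rm MLE}(\bar b)=1$ and $\hat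 u_{\rm MLE}(y)=\frac{\bar\beta_j}{\gamma}(y-y_j)+\frac{\bar\alpha_j}{\gamma}$ for $y_j\le y<y_{j+1}$. If $\gamma=0$, then $\hat\sigma_{\rm MLE}=+\infty$ and $\hat u_{\rm MLE}/\hat\sigma_{\rm MLE}$ is read as $0$. \textbf{Theorem.} For any $\lambda>0$ and any $\delta\in(0,1)$, with probability at least $1-\delta$, the following holds for every optimal solution of the program: $$\sup_{y\in[0,\bar b]}\left|\frac{\hat u_{\rm MLE}(y)}{\hat\sigma_{\rm MLE}}-\frac{u^*(y)}{\sigma^*}\right|\le L\bar c\,\mu_N+\frac{\sqrt{\frac{R_D+2\sqrt{-R_D\log\delta}-2\log\delta}{\omega^2K}}+\sqrt{\frac{R_D+2\sqrt{-R_D\log\delta}-2\log\delta}{\omega^2K}+\lambda\left(\bar c\sqrt{N-1}\right)^2}}{\sqrt{\lambda_{\min}(\Sigma_D+\lambda\mathbf I)}},$$ where $\lambda_{\min}$ denotes the smallest eigenvalue. -/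

import Mathlib

open MeasureTheory ProbabilityTheory

namespace PrefElicit

noncomputable section

/-- The class `U_c`: utility functions on `[0, b]` that are monotonically increasing, concave,
Lipschitz with modulus at most `L`, and normalised by `u 0 = 0`, `u b = 1`.
Only the values on `[0, b]` matter. -/
def utilityClass (b L : ℝ) : Set (ℝ → ℝ) :=
  {u | MonotoneOn u (Set.Icc 0 b) ∧ ConcaveOn ℝ (Set.Icc 0 b) u ∧
    (∀ s ∈ Set.Icc 0 b, ∀ t ∈ Set.Icc 0 b, |u s - u t| ≤ L * |s - t|) ∧
    u 0 = 0 ∧ u b = 1}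

/-- The Gumbel distribution with location `0` and scale `σ`, given by its density
`x ↦ (1/σ) exp(-x/σ) exp(-exp(-x/σ))`; its distribution function is `x ↦ exp(-exp(-x/σ))`. -/
def gumbelMeasure (σ : ℝ) : Measure ℝ :=
  volume.withDensity fun x =>
    ENNReal.ofReal (1 / σ * Real.exp (-x / σ) * Real.exp (-Real.exp (-x / σ)))

section Model

variable {Ω : Type*} [MeasurableSpace Ω]

/-- The set of atoms of the random variable `X`; for a discrete `X` this is its support. -/
def atoms (μ : Measure Ω) (X : Ω → ℝ) : Set ℝ :=
  {x | μ (X ⁻¹' {x}) ≠ 0}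

/-- A lottery: a discretely distributed random variable with finite support in `[0, b]`. -/
structure IsLottery (μ : Measure Ω) (b : ℝ) (X : Ω → ℝ) : Prop where
  aemeasurable : AEMeasurable X μ
  finite_support : (atoms μ X).Finite
  support_subset : atoms μ X ⊆ Set.Icc 0 b
  ae_mem_support : ∀ᵐ ω ∂μ, X ω ∈ atoms μ X

/-- The random utility `U(X) = E[u(X)] + e` with response error `e`. -/
def randomUtility (μ : Measure Ω) (u : ℝ → ℝ) (X : Ω → ℝ) (e : Ω → ℝ) (ω : Ω) : ℝ :=
  (∫ ω', u (X ω') ∂μ) + e ω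

open Classical in
/-- The vector of observed choices: `Z k = 1` if `U(W k) ≥ U(Y k)`, and `Z k = -1` otherwise.
The errors in the `k`-th query are `ε (k, 0)` (for `W k`) and `ε (k, 1)` (for `Y k`). -/
def choices {K : ℕ} (μ : Measure Ω) (u : ℝ → ℝ) (W Y : Fin K → Ω → ℝ)
    (ε : Fin K × Fin 2 → Ω → ℝ) (ω : Ω) (k : Fin K) : ℝ :=
  if randomUtility μ u (Y k) (ε (k, 1)) ω ≤ randomUtility μ u (W k) (ε (k, 0)) ω then 1 else -1

/-- The set of breakpoints `{0} ∪ ⋃ supp(W k) ∪ ⋃ supp(Y k) ∪ {b}`. -/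
def breakpointSet {K : ℕ} (μ : Measure Ω) (b : ℝ) (W Y : Fin K → Ω → ℝ) : Set ℝ :=
  {0} ∪ (⋃ k, atoms μ (W k)) ∪ (⋃ k, atoms μ (Y k)) ∪ {b}

/-- The probability-mass differences `p k j = ℙ(W k = y j) - ℙ(Y k = y j)`. -/
def massDiff {K N : ℕ} (μ : Measure Ω) (W Y : Fin K → Ω → ℝ) (y : Fin N → ℝ)
    (k : Fin K) (j : Fin N) : ℝ :=
  μ.real (W k ⁻¹' {y j}) - μ.real (Y k ⁻¹' {y j})

end Model

/-! Below the number of breakpoints is written `N = m + 2` (there are always at least two,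
namely `0` and the right endpoint), and `p` stands for the probability-mass differences. -/

section Estimator

variable {K m : ℕ}

/-- The log-likelihood `-∑ k, log (1 + exp (∑ j, -Z k * p k j * α j))`. -/
def logLikelihood (p : Fin K → Fin (m + 2) → ℝ) (Z : Fin K → ℝ) (α : Fin (m + 2) → ℝ) : ℝ :=
  -∑ k, Real.log (1 + Real.exp (∑ j, -Z k * p k j * α j))

/-- The constraints of the maximum likelihood program in the variables `(α, β, γ)`, where
`α` are utility values divided by `σ`, `β` the slopes, and `γ = 1/σ` (`γ = 0` being `σ = +∞`). -/
structure Feasible (L c : ℝ) (y : Fin (m + 2) → ℝ)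
    (α : Fin (m + 2) → ℝ) (β : Fin (m + 1) → ℝ) (γ : ℝ) : Prop where
  slope : ∀ j : Fin (m + 1), β j = (α j.succ - α j.castSucc) / (y j.succ - y j.castSucc)
  concave : ∀ j : Fin m, β j.succ ≤ β j.castSucc
  lipschitz : β 0 ≤ L * γ
  monotone : 0 ≤ β (Fin.last m)
  left_value : α 0 = 0
  right_value : α (Fin.last (m + 1)) = γ
  gamma_mem : γ ∈ Set.Icc 0 c

/-- `(α, β, γ)` is an optimal solution of the maximum likelihood program. -/
def IsOptimal (L c : ℝ) (y : Fin (m + 2) → ℝ) (p : Fin K → Fin (m + 2) → ℝ) (Z : Fin K → ℝ)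
    (α : Fin (m + 2) → ℝ) (β : Fin (m + 1) → ℝ) (γ : ℝ) : Prop :=
  Feasible L c y α β γ ∧
    ∀ (α' : Fin (m + 2) → ℝ) (β' : Fin (m + 1) → ℝ) (γ' : ℝ),
      Feasible L c y α' β' γ' → logLikelihood p Z α' ≤ logLikelihood p Z α

open Classical in
/-- The piecewise linear function on `[y 0, y (last)]` with value `0` at the left endpoint, `1` at
the right endpoint, and `β j * (t - y j) + α j` for `y j ≤ t < y (j+1)`
(for strictly increasing `y` at most one summand is nonzero). -/
def piecewiseLinear (y : Fin (m + 2) → ℝ) (α : Fin (m + 2) → ℝ) (β : Fin (m + 1) → ℝ)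
    (t : ℝ) : ℝ :=
  if t = y 0 then 0
  else if t = y (Fin.last (m + 1)) then 1
  else ∑ j : Fin (m + 1),
    if y j.castSucc ≤ t ∧ t < y j.succ then β j * (t - y j.castSucc) + α j.castSucc else 0

/-- The estimated scale parameter `1/γ` (for `γ > 0`). -/
def sigmaMLE (γ : ℝ) : ℝ := 1 / γ

/-- The estimated utility function obtained from an optimal `(α, β, γ)` with `γ > 0`: the
piecewise linear function with values `α / γ` and slopes `β / γ`. -/
def uMLE (y : Fin (m + 2) → ℝ) (α : Fin (m + 2) → ℝ) (β : Fin (m + 1) → ℝ) (γ : ℝ) : ℝ → ℝ :=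
  piecewiseLinear y (fun j => α j / γ) (fun j => β j / γ)

open Classical in
/-- The estimated adjusted utility function: the estimated utility function divided by the
estimated scale. For `γ = 0` the estimated scale is `+∞` and the quotient is `0`. -/
def adjustedMLE (y : Fin (m + 2) → ℝ) (α : Fin (m + 2) → ℝ) (β : Fin (m + 1) → ℝ) (γ : ℝ)
    (t : ℝ) : ℝ :=
  if γ = 0 then 0 else uMLE y α β γ t / sigmaMLE γ

/-- The Kolmogorov distance `sup_{t ∈ [a, b]} |f t - g t|`, as an extended nonnegative real. -/
def kolmogorovDist (a b : ℝ) (f g : ℝ → ℝ) : ENNReal :=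
  ⨆ t ∈ Set.Icc a b, ENNReal.ofReal |f t - g t|

/-- The mesh size `max_j (y (j+1) - y j)`. -/
def mesh (y : Fin (m + 2) → ℝ) : ℝ :=
  Finset.univ.sup' Finset.univ_nonempty fun j : Fin (m + 1) => y j.succ - y j.castSucc

/-- The reduced probability-mass difference matrix, of size `K × (N-1)`: the first breakpoint is
dropped. -/
def reducedMatrix (p : Fin K → Fin (m + 2) → ℝ) : Matrix (Fin K) (Fin (m + 1)) ℝ :=
  Matrix.of fun k j => p k j.succ

/-- The empirical information matrix `(1/K) Pᵀ P`. -/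
def infoMatrix (p : Fin K → Fin (m + 2) → ℝ) : Matrix (Fin (m + 1)) (Fin (m + 1)) ℝ :=
  (1 / (K : ℝ)) • ((reducedMatrix p).transpose * reducedMatrix p)

/-- The smallest eigenvalue of a real symmetric matrix. -/
def minEigenvalue {n : ℕ} (A : Matrix (Fin n) (Fin n) ℝ) : ℝ := sInf (spectrum ℝ A)

/-- The constant `ω = 1 / (2 + 2 exp(2c))`. -/
def omegaConst (c : ℝ) : ℝ := 1 / (2 + 2 * Real.exp (2 * c))

/-- The quantity `(R + 2 √(-R log δ) - 2 log δ) / (ω² K)`, with `R` the rank of the empirical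
information matrix. -/
def noiseTerm (c δ : ℝ) (p : Fin K → Fin (m + 2) → ℝ) : ℝ :=
  (((infoMatrix p).rank : ℝ) + 2 * √(-((infoMatrix p).rank : ℝ) * Real.log δ)
    - 2 * Real.log δ) / (omegaConst c ^ 2 * K)

/-- The estimation error bound; `m + 1` is `N - 1`. -/
def estimationBound (c lam δ : ℝ) (p : Fin K → Fin (m + 2) → ℝ) : ℝ :=
  (√(noiseTerm c δ p) + √(noiseTerm c δ p + lam * (c * √((m : ℝ) + 1)) ^ 2)) /
    √(minEigenvalue (infoMatrix p + lam • (1 : Matrix (Fin (m + 1)) (Fin (m + 1)) ℝ)))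

end Estimator

end

end PrefElicit

/-! The argument is the basic inequality for maximum likelihood combined with curvature of the
logistic loss. A difference of two Gumbel errors is logistic, so the program maximises the true
log-likelihood of the choices, and the true utility sampled at the breakpoints and divided by
`σStar` is feasible. Comparing an optimum with it, and using that the loss has second derivative at
least `omegaConst c` on `[-c, c]`, bounds the prediction error `d = P x`, where `x` is the
coefficient error, by the inner product of `d` with the score vector
(`IsOptimal.norm_prediction_error_le`). As `d` lies in the column space of `P`, only the projection
of the score onto that space counts, which is why the rank enters and not `K`.

The scores are independent, centred and confined to intervals of length 1, hence sub-Gaussian with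
parameter `1/4`. Averaging against an independent Gaussian vector gives an exponential moment of the
squared norm of their projection, and Markov's inequality gives the tail
(`measure_norm_starProjection_sq_le`).

The passage from `d` to `x` uses the smallest eigenvalue of the regularised information matrix, at
the price of the term `lam * ‖x‖ ^ 2`, which is controlled because all coefficients lie in `[0, c]`.
Between breakpoints, monotonicity and the Lipschitz bound add `L * c * mesh y`
(`kolmogorovDist_adjustedMLE_le`). -/

namespace PrefElicit

/-! ### Concentration of projected sub-Gaussian vectors -/

section Concentration

open scoped NNReal

/-- Since `-x²/2 + x²/8 = -x²/(2 · 4/3)`, the integrand is `√(4/3)` times the density of variance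
`4/3`, and `4/3 ≤ e`. -/
lemma lintegral_exp_sq_div_eight_gaussianReal :
    ∫⁻ x, ENNReal.ofReal (Real.exp (x ^ 2 / 8)) ∂(gaussianReal 0 1) ≤
      ENNReal.ofReal (Real.exp (1 / 2)) := by
  have h43 : (4 / 3 : ℝ≥0) ≠ 0 := by norm_num
  rw [gaussianReal_of_var_ne_zero 0 one_ne_zero,
    lintegral_withDensity_eq_lintegral_mul _ (measurable_gaussianPDF 0 1) (by fun_prop)]
  have key : ∀ x : ℝ, (gaussianPDF 0 1 * fun x : ℝ => ENNReal.ofReal (Real.exp (x ^ 2 / 8))) x =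
      ENNReal.ofReal (√(4 / 3)) * gaussianPDF 0 (4 / 3) x := by
    intro x
    simp only [Pi.mul_apply, gaussianPDF]
    rw [← ENNReal.ofReal_mul (gaussianPDFReal_nonneg _ _ _), ← ENNReal.ofReal_mul (by positivity)]
    congr 1
    simp only [gaussianPDFReal, sub_zero, NNReal.coe_one, mul_one]
    have e1 : ((4 / 3 : ℝ≥0) : ℝ) = 4 / 3 := by norm_num
    rw [e1, mul_comm (2 * Real.pi) (4 / 3 : ℝ), Real.sqrt_mul (by norm_num) (2 * Real.pi), mul_inv,
      mul_assoc, ← Real.exp_add, ← mul_assoc, ← mul_assoc,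
      mul_inv_cancel₀ (by positivity), one_mul]
    congr 2
    ring
  simp_rw [key]
  rw [lintegral_const_mul _ (measurable_gaussianPDF _ _), lintegral_gaussianPDF_eq_one _ h43,
    mul_one]
  apply ENNReal.ofReal_le_ofReal
  rw [Real.sqrt_le_left (by positivity), ← Real.exp_nat_mul]
  have := Real.add_one_le_exp (1 : ℝ)
  norm_num
  linarith

lemma lintegral_exp_mul_gaussianReal (a : ℝ) :
    ∫⁻ x, ENNReal.ofReal (Real.exp (a * x)) ∂(gaussianReal 0 1) =
      ENNReal.ofReal (Real.exp (a ^ 2 / 2)) := by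
  rw [← ofReal_integral_eq_lintegral_ofReal (integrable_exp_mul_gaussianReal a)
    (ae_of_all _ fun x => (Real.exp_pos _).le)]
  congr 1
  have := mgf_gaussianReal (p := gaussianReal 0 1) (X := id) (μ := 0) (v := 1) (by simp) a
  simpa [mgf] using this

lemma lintegral_prod_pi_gaussianReal {n : ℕ} (f : Fin n → ℝ → ENNReal)
    (hf : ∀ i, Measurable (f i)) :
    ∫⁻ g, ∏ i, f i (g i) ∂(Measure.pi fun _ : Fin n => gaussianReal 0 1) =
      ∏ i, ∫⁻ x, f i x ∂(gaussianReal 0 1) := by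
  rw [lintegral_prod_eq_prod_lintegral_of_indepFun Finset.univ
    (fun i (g : Fin n → ℝ) => f i (g i)) (iIndepFun_pi fun i => (hf i).aemeasurable)
    fun i => (hf i).comp (measurable_pi_apply i)]
  refine Finset.prod_congr rfl fun i _ => ?_
  exact (measurePreserving_eval (fun _ : Fin n => gaussianReal 0 1) i).lintegral_comp (hf i)

variable {Ω : Type*} [MeasurableSpace Ω] {μ : Measure Ω}

lemma lintegral_exp_sum_mul_swap [SFinite μ] {n : ℕ} (w : Ω → Fin n → ℝ) (hw : AEMeasurable w μ)
    (γ : Measure (Fin n → ℝ)) [SFinite γ] :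
    ∫⁻ ω, ∫⁻ g, ENNReal.ofReal (Real.exp (∑ i, w ω i * g i)) ∂γ ∂μ =
      ∫⁻ g, ∫⁻ ω, ENNReal.ofReal (Real.exp (∑ i, w ω i * g i)) ∂μ ∂γ := by
  have hm : Measurable fun q : (Fin n → ℝ) × (Fin n → ℝ) =>
      ENNReal.ofReal (Real.exp (∑ i, q.1 i * q.2 i)) := by fun_prop
  have hp : AEMeasurable (fun z : Ω × (Fin n → ℝ) => (w z.1, z.2)) (μ.prod γ) :=
    (hw.comp_quasiMeasurePreserving Measure.quasiMeasurePreserving_fst).prodMk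
      measurable_snd.aemeasurable
  have hF := hm.comp_aemeasurable hp
  exact lintegral_lintegral_swap hF

/-- A random vector whose exponential moments are dominated by those of a centred Gaussian vector
with covariance `1/4` has a square norm with a dominated exponential moment. -/
lemma lintegral_exp_half_sq_le [IsProbabilityMeasure μ] {n : ℕ} (w : Ω → Fin n → ℝ)
    (hw : AEMeasurable w μ)
    (h : ∀ g : Fin n → ℝ, ∫⁻ ω, ENNReal.ofReal (Real.exp (∑ i, w ω i * g i)) ∂μ ≤
      ENNReal.ofReal (Real.exp (∑ i, g i ^ 2 / 8))) :
    ∫⁻ ω, ENNReal.ofReal (Real.exp ((∑ i, w ω i ^ 2) / 2)) ∂μ ≤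
      ENNReal.ofReal (Real.exp ((n : ℝ) / 2)) := by
  let γ : Measure (Fin n → ℝ) := Measure.pi fun _ => gaussianReal 0 1
  have : IsProbabilityMeasure γ := by unfold γ; infer_instance
  have expand : ∀ a : Fin n → ℝ, ENNReal.ofReal (Real.exp (∑ i, a i)) =
      ∏ i, ENNReal.ofReal (Real.exp (a i)) := fun a => by
    rw [Real.exp_sum, ENNReal.ofReal_prod_of_nonneg fun i _ => (Real.exp_pos _).le]
  -- For a standard Gaussian `g`, `exp (‖w‖²/2)` is the mean of `exp ⟨w, g⟩`. Exchanging the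
  -- integrals makes the hypothesis on linear functionals of `w` applicable for each fixed `g`.
  calc ∫⁻ ω, ENNReal.ofReal (Real.exp ((∑ i, w ω i ^ 2) / 2)) ∂μ
      = ∫⁻ ω, ∫⁻ g, ENNReal.ofReal (Real.exp (∑ i, w ω i * g i)) ∂γ ∂μ := by
        refine lintegral_congr fun ω => ?_
        simp_rw [expand]
        rw [lintegral_prod_pi_gaussianReal (fun i x => ENNReal.ofReal (Real.exp (w ω i * x)))
          fun i => by fun_prop, Finset.sum_div, expand]
        simp_rw [lintegral_exp_mul_gaussianReal]
    _ = ∫⁻ g, ∫⁻ ω, ENNReal.ofReal (Real.exp (∑ i, w ω i * g i)) ∂μ ∂γ := by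
        exact lintegral_exp_sum_mul_swap w hw γ
    _ ≤ ∫⁻ g, ∏ i, ENNReal.ofReal (Real.exp (g i ^ 2 / 8)) ∂γ := by
        refine lintegral_mono fun g => ?_
        rw [← expand]
        exact h g
    _ ≤ ENNReal.ofReal (Real.exp ((n : ℝ) / 2)) := by
        rw [lintegral_prod_pi_gaussianReal (fun i x => ENNReal.ofReal (Real.exp (x ^ 2 / 8)))
          fun i => by fun_prop]
        refine (Finset.prod_le_pow_card _ _ _
          fun i _ => lintegral_exp_sq_div_eight_gaussianReal).trans_eq ?_
        rw [Finset.card_univ, Fintype.card_fin, ← ENNReal.ofReal_pow (Real.exp_pos _).le,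
          ← Real.exp_nat_mul]
        congr 2
        ring

/-- Concentration of the square norm of a projection of a vector of independent sub-Gaussian
variables to a subspace. -/
lemma measure_norm_starProjection_sq_le [IsProbabilityMeasure μ] {K : ℕ} (V : Fin K → Ω → ℝ)
    (hind : iIndepFun V μ) (hsub : ∀ k, HasSubgaussianMGF (V k) (1 / 4) μ)
    (S : Submodule ℝ (EuclideanSpace ℝ (Fin K))) (t : ℝ) :
    μ {ω | (Module.finrank ℝ S : ℝ) + 2 * t <
        ‖S.starProjection (WithLp.toLp 2 fun k => V k ω)‖ ^ 2} ≤
      ENNReal.ofReal (Real.exp (-t)) := by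
  set n := Module.finrank ℝ S
  let q : OrthonormalBasis (Fin n) ℝ S := stdOrthonormalBasis ℝ S
  let x : Ω → EuclideanSpace ℝ (Fin K) := fun ω => WithLp.toLp 2 fun k => V k ω
  -- These are the coordinates of the projection in an orthonormal basis of `S`; they need not be
  -- independent, only their joint exponential moments matter.
  let w : Ω → Fin n → ℝ := fun ω i => ∑ k, (q i : EuclideanSpace ℝ (Fin K)) k * V k ω
  have hnorm : ∀ ω, ‖S.starProjection (x ω)‖ ^ 2 = ∑ i, w ω i ^ 2 := by
    intro ω
    rw [Submodule.starProjection_apply, ← Submodule.coe_norm, ← q.sum_sq_norm_inner_right]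
    refine Finset.sum_congr rfl fun i _ => ?_
    rw [Real.norm_eq_abs, sq_abs, Submodule.inner_orthogonalProjectionOnto_eq_of_mem_left]
    simp [w, x, PiLp.inner_apply, mul_comm]
  have hVm : ∀ k, AEMeasurable (V k) μ := fun k => (hsub k).aemeasurable
  have hw : AEMeasurable w μ := by
    refine aemeasurable_pi_lambda _ fun i => ?_
    exact Finset.aemeasurable_fun_sum _ fun k _ => (hVm k).const_mul _
  have hmgf : ∀ g : Fin n → ℝ, ∫⁻ ω, ENNReal.ofReal (Real.exp (∑ i, w ω i * g i)) ∂μ ≤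
      ENNReal.ofReal (Real.exp (∑ i, g i ^ 2 / 8)) := by
    intro g
    let a : EuclideanSpace ℝ (Fin K) := ((∑ i, g i • q i : S) : EuclideanSpace ℝ (Fin K))
    have ha : ∀ k, a k = ∑ i, g i * (q i : EuclideanSpace ℝ (Fin K)) k := by
      intro k
      simp [a]
    have hna : ∑ k, a k ^ 2 = ∑ i, g i ^ 2 := by
      have h1 : ‖a‖ ^ 2 = ∑ k, a k ^ 2 := by simp [EuclideanSpace.norm_sq_eq]
      rw [← h1, Submodule.norm_coe, ← q.sum_sq_norm_inner_right]
      refine Finset.sum_congr rfl fun i _ => ?_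
      rw [q.orthonormal.inner_right_fintype]
      simp
    have hsum : ∀ ω, ∑ i, w ω i * g i = ∑ k, a k * V k ω := by
      intro ω
      simp_rw [ha, w, Finset.sum_mul]
      rw [Finset.sum_comm]
      refine Finset.sum_congr rfl fun k _ => Finset.sum_congr rfl fun i _ => ?_
      ring
    have hsub' : ∀ k, HasSubgaussianMGF (fun ω => a k * V k ω)
        ((a k ^ 2).toNNReal * (1 / 4)) μ := fun k => by
      rw [Real.toNNReal_of_nonneg (sq_nonneg _)]
      exact (hsub k).const_mul (a k)
    have hS := HasSubgaussianMGF.sum_of_iIndepFun (s := Finset.univ)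
      (hind.comp (fun k v => a k * v) fun k => measurable_const_mul _)
      (fun k _ => hsub' k)
    have hle := hS.mgf_le 1
    have hint := hS.integrable_exp_mul 1
    simp only [one_mul, Function.comp_apply, mgf] at hle hint
    simp_rw [hsum]
    rw [← ofReal_integral_eq_lintegral_ofReal hint (ae_of_all _ fun x => (Real.exp_pos _).le)]
    refine ENNReal.ofReal_le_ofReal (hle.trans_eq ?_)
    rw [NNReal.coe_sum, ← Finset.sum_div, ← hna]
    congr 1
    simp only [NNReal.coe_mul, Real.coe_toNNReal _ (sq_nonneg _), ← Finset.sum_mul]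
    norm_num
    ring
  have hmain := lintegral_exp_half_sq_le w hw hmgf
  -- The level `exp ((n + 2 * t) / 2)` exceeds the moment bound `exp (n / 2)` by exactly the factor
  -- `exp t`.
  have hmark := mul_meas_ge_le_lintegral₀ (μ := μ)
    (f := fun ω => ENNReal.ofReal (Real.exp ((∑ i, w ω i ^ 2) / 2))) (by
      have hm : Measurable fun u : Fin n → ℝ =>
        ENNReal.ofReal (Real.exp ((∑ i, u i ^ 2) / 2)) := by fun_prop
      exact hm.comp_aemeasurable hw) (ENNReal.ofReal (Real.exp ((n + 2 * t) / 2)))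
  have hle := hmark.trans hmain
  have hpos : ENNReal.ofReal (Real.exp (((n : ℝ) + 2 * t) / 2)) ≠ 0 := by
    simp [Real.exp_pos]
  have hsplit : ENNReal.ofReal (Real.exp ((n : ℝ) / 2)) =
      ENNReal.ofReal (Real.exp (((n : ℝ) + 2 * t) / 2)) * ENNReal.ofReal (Real.exp (-t)) := by
    rw [← ENNReal.ofReal_mul (Real.exp_pos _).le, ← Real.exp_add]
    congr 2
    ring
  rw [hsplit, ENNReal.mul_le_mul_iff_right hpos ENNReal.ofReal_ne_top] at hle
  refine (measure_mono fun ω hω => ?_).trans hle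
  rw [Set.mem_ofPred_eq, hnorm ω] at hω
  refine ENNReal.ofReal_le_ofReal (Real.exp_le_exp.2 ?_)
  linarith

end Concentration

/-! ### Gumbel differences are logistic -/

section Gumbel

open Filter Topology

lemma hasDerivAt_exp_neg_exp {σ : ℝ} (x : ℝ) :
    HasDerivAt (fun x => Real.exp (-Real.exp (-x / σ)))
      (1 / σ * Real.exp (-x / σ) * Real.exp (-Real.exp (-x / σ))) x := by
  have h1 : HasDerivAt (fun x : ℝ => -x / σ) (-1 / σ) x := (hasDerivAt_id x).neg.div_const σ
  have h2 : HasDerivAt (fun x : ℝ => -Real.exp (-x / σ)) (-(Real.exp (-x / σ) * (-1 / σ))) x :=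
    h1.exp.neg
  convert h2.exp using 1
  ring

lemma tendsto_exp_neg_exp {σ : ℝ} (hσ : 0 < σ) :
    Tendsto (fun x => Real.exp (-Real.exp (-x / σ))) atTop (𝓝 1) := by
  have h1 : Tendsto (fun x : ℝ => -x / σ) atTop atBot :=
    tendsto_neg_atTop_atBot.atBot_div_const hσ
  have h2 := (Real.tendsto_exp_atBot.comp h1).neg.rexp
  simpa using h2

lemma gumbelMeasure_Iic {σ : ℝ} (hσ : 0 < σ) [IsProbabilityMeasure (gumbelMeasure σ)] (x : ℝ) :
    gumbelMeasure σ (Set.Iic x) = ENNReal.ofReal (Real.exp (-Real.exp (-x / σ))) := by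
  have hd : ∀ z : ℝ, 0 ≤ 1 / σ * Real.exp (-z / σ) * Real.exp (-Real.exp (-z / σ)) :=
    fun z => by positivity
  -- The upper tail needs only the limit of the antiderivative at `+∞`; the total mass 1 then gives
  -- the lower tail.
  have hI : gumbelMeasure σ (Set.Ioi x) =
      ENNReal.ofReal (1 - Real.exp (-Real.exp (-x / σ))) := by
    rw [gumbelMeasure, withDensity_apply _ measurableSet_Ioi,
      ← ofReal_integral_eq_lintegral_ofReal
        (integrableOn_Ioi_deriv_of_nonneg' (fun z _ => hasDerivAt_exp_neg_exp z)
          (fun z _ => hd z) (tendsto_exp_neg_exp hσ)) (ae_of_all _ hd),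
      integral_Ioi_of_hasDerivAt_of_nonneg' (fun z _ => hasDerivAt_exp_neg_exp z)
          (fun z _ => hd z) (tendsto_exp_neg_exp hσ)]
  have hle : Real.exp (-Real.exp (-x / σ)) ≤ 1 :=
    Real.exp_le_one_iff.2 (neg_nonpos.2 (Real.exp_pos _).le)
  rw [← Set.compl_Ioi, prob_compl_eq_one_sub measurableSet_Ioi, hI, ← ENNReal.ofReal_one,
    ← ENNReal.ofReal_sub _ (by linarith)]
  congr 1
  ring

lemma lintegral_exp_neg_exp_gumbelMeasure {σ : ℝ} (hσ : 0 < σ)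
    [IsProbabilityMeasure (gumbelMeasure σ)] (a : ℝ) :
    ∫⁻ x, ENNReal.ofReal (Real.exp (-Real.exp (-(x + a) / σ))) ∂(gumbelMeasure σ) =
      ENNReal.ofReal (1 / (1 + Real.exp (-(a / σ)))) := by
  set d : ℝ → ENNReal := fun x =>
    ENNReal.ofReal (1 / σ * Real.exp (-x / σ) * Real.exp (-Real.exp (-x / σ))) with hd
  have hdm : Measurable d := by fun_prop
  have htot : ∫⁻ x, d x = 1 := by
    have := measure_univ (μ := gumbelMeasure σ)
    rwa [gumbelMeasure, withDensity_apply _ MeasurableSet.univ, Measure.restrict_univ] at this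
  set A := 1 + Real.exp (-(a / σ)) with hA
  have hA0 : 0 < A := by positivity
  -- The product of the two double exponentials is again one, with `exp (-x / σ)` multiplied by `A`.
  -- This amounts to translating by `σ * log A`, so the integral is `1 / A` by translation
  -- invariance.
  have hshift : ∀ x, d x * ENNReal.ofReal (Real.exp (-Real.exp (-(x + a) / σ))) =
      ENNReal.ofReal (1 / A) * d (x - σ * Real.log A) := by
    intro x
    have e1 : Real.exp (-(x - σ * Real.log A) / σ) = Real.exp (-x / σ) * A := by
      rw [← Real.exp_log hA0, ← Real.exp_add, Real.log_exp]
      congr 1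
      field_simp
      ring
    have e2 : Real.exp (-(x + a) / σ) = Real.exp (-x / σ) * Real.exp (-(a / σ)) := by
      rw [← Real.exp_add]
      congr 1
      ring
    simp only [hd]
    rw [← ENNReal.ofReal_mul (by positivity), ← ENNReal.ofReal_mul (by positivity), e1, e2,
      mul_assoc, ← Real.exp_add, hA]
    congr 1
    rw [show -Real.exp (-x / σ) + -(Real.exp (-x / σ) * Real.exp (-(a / σ))) =
      -(Real.exp (-x / σ) * (1 + Real.exp (-(a / σ)))) by ring]
    field_simp
  rw [gumbelMeasure, lintegral_withDensity_eq_lintegral_mul _ hdm (by fun_prop)]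
  simp only [Pi.mul_apply, hshift]
  rw [lintegral_const_mul _ (by fun_prop), lintegral_sub_right_eq_self d, htot, mul_one]

lemma measure_gumbel_le_add {Ω : Type*} [MeasurableSpace Ω] {μ : Measure Ω}
    [IsProbabilityMeasure μ] {σ : ℝ} (hσ : 0 < σ) {X₀ X₁ : Ω → ℝ}
    (h₀ : HasLaw X₀ (gumbelMeasure σ) μ) (h₁ : HasLaw X₁ (gumbelMeasure σ) μ)
    (hind : IndepFun X₀ X₁ μ) (a : ℝ) :
    μ {ω | X₁ ω ≤ X₀ ω + a} = ENNReal.ofReal (1 / (1 + Real.exp (-(a / σ)))) := by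
  have : IsProbabilityMeasure (gumbelMeasure σ) :=
    h₀.map_eq ▸ Measure.isProbabilityMeasure_map h₀.aemeasurable
  have hlaw := (indepFun_iff_hasLaw_prodMk_prod h₀ h₁).1 hind
  have hs : MeasurableSet {q : ℝ × ℝ | q.2 ≤ q.1 + a} :=
    measurableSet_le measurable_snd (measurable_fst.add_const a)
  rw [hlaw.measure_eq (p := fun q : ℝ × ℝ => q.2 ≤ q.1 + a) hs, Measure.prod_apply hs,
    ← lintegral_exp_neg_exp_gumbelMeasure hσ]
  exact lintegral_congr fun x => gumbelMeasure_Iic hσ (x + a)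

end Gumbel

/-! ### Independence of blocks -/

section Independence

/-- Currying a doubly indexed independent family gives an independent family of blocks. -/
lemma iIndepFun_curry {Ω ι κ : Type*} [MeasurableSpace Ω] {μ : Measure Ω}
    [IsProbabilityMeasure μ] [Countable ι] [Countable κ] {X : ι × κ → Ω → ℝ}
    (hX : ∀ p, AEMeasurable (X p) μ) (h : iIndepFun X μ) :
    iIndepFun (fun i ω j => X (i, j) ω) μ := by
  have hp : ∀ i j, IsProbabilityMeasure (μ.map (X (i, j))) := fun i j =>
    Measure.isProbabilityMeasure_map (hX _)
  have hblock : ∀ i, AEMeasurable (fun ω j => X (i, j) ω) μ := fun i =>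
    aemeasurable_pi_lambda _ fun j => hX _
  have hall : AEMeasurable (fun ω p => X p ω) μ := aemeasurable_pi_lambda _ hX
  rw [iIndepFun_iff_map_fun_eq_infinitePi_map₀' hblock]
  have hrow : ∀ i, μ.map (fun ω j => X (i, j) ω) =
      Measure.infinitePi fun j => μ.map (X (i, j)) := fun i =>
    (h.precomp (g := fun j : κ => (i, j)) fun a b hab => (Prod.mk.inj hab).2)
      |>.map_fun_eq_infinitePi_map₀' fun j => hX _
  simp_rw [hrow]
  rw [← Measure.infinitePi_map_curry (fun i j => μ.map (X (i, j))),
    ← h.map_fun_eq_infinitePi_map₀' hX, AEMeasurable.map_map_of_aemeasurable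
      (MeasurableEquiv.measurable _).aemeasurable hall]
  rfl

end Independence

/-! ### The score vector at the truth -/

section Score

/-- The derivative of `t ↦ log (1 + exp (-(z * t)))`. -/
noncomputable def score (z t : ℝ) : ℝ := -z / (1 + Real.exp (z * t))

lemma score_neg_one_eq (t : ℝ) : score (-1) t = score 1 t + 1 := by
  have h : Real.exp (-t) * Real.exp t = 1 := by rw [← Real.exp_add]; simp
  unfold score
  rw [neg_mul, one_mul]
  field_simp
  linear_combination -h

lemma score_neg_one (t : ℝ) : score (-1) t = 1 / (1 + Real.exp (-t)) := by
  simp [score]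

variable {Ω : Type*} [MeasurableSpace Ω] {μ : Measure Ω} [IsProbabilityMeasure μ] {K : ℕ}
  {u : ℝ → ℝ} {W Y : Fin K → Ω → ℝ} {ε : Fin K × Fin 2 → Ω → ℝ} {σ : ℝ}

/-- The scores of the observed choices at the true parameters. -/
noncomputable def choiceScore (μ : Measure Ω) (u : ℝ → ℝ) (W Y : Fin K → Ω → ℝ)
    (ε : Fin K × Fin 2 → Ω → ℝ) (σ : ℝ) (k : Fin K) (ω : Ω) : ℝ :=
  score (choices μ u W Y ε ω k) (((∫ x, u (W k x) ∂μ) - ∫ x, u (Y k x) ∂μ) / σ)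

open Classical in
lemma iIndepFun_choiceScore (hε : ∀ i, AEMeasurable (ε i) μ) (hind : iIndepFun ε μ) :
    iIndepFun (choiceScore μ u W Y ε σ) μ := by
  let t : Fin K → ℝ := fun k => ((∫ x, u (W k x) ∂μ) - ∫ x, u (Y k x) ∂μ) / σ
  let φ : Fin K → (Fin 2 → ℝ) → ℝ := fun k e =>
    score (if (∫ x, u (Y k x) ∂μ) + e 1 ≤ (∫ x, u (W k x) ∂μ) + e 0 then 1 else -1) (t k)
  have hφ : ∀ k, Measurable (φ k) := by
    intro k
    have hs : MeasurableSet {e : Fin 2 → ℝ |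
        (∫ x, u (Y k x) ∂μ) + e 1 ≤ (∫ x, u (W k x) ∂μ) + e 0} :=
      measurableSet_le (by fun_prop) (by fun_prop)
    have hz : Measurable fun e : Fin 2 → ℝ =>
        if (∫ x, u (Y k x) ∂μ) + e 1 ≤ (∫ x, u (W k x) ∂μ) + e 0 then (1 : ℝ) else -1 :=
      Measurable.ite hs measurable_const measurable_const
    have hsc : Measurable fun z => score z (t k) := by
      unfold score
      fun_prop
    exact hsc.comp hz
  exact (iIndepFun_curry hε hind).comp φ hφ

lemma hasSubgaussianMGF_choiceScore (hσ : 0 < σ)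
    (hε : ∀ i, HasLaw (ε i) (gumbelMeasure σ) μ) (hind : iIndepFun ε μ) (k : Fin K) :
    HasSubgaussianMGF (choiceScore μ u W Y ε σ k) (1 / 4) μ := by
  set EW := ∫ x, u (W k x) ∂μ
  set EY := ∫ x, u (Y k x) ∂μ
  set t := (EW - EY) / σ
  set E : Set Ω := {ω | ε (k, 1) ω ≤ ε (k, 0) ω + (EW - EY)} with hE
  have hm0 := (hε (k, 0)).aemeasurable
  have hm1 := (hε (k, 1)).aemeasurable
  have hEm : NullMeasurableSet E μ := nullMeasurableSet_le hm1 (hm0.add_const _)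
  have hμE : μ E = ENNReal.ofReal (score (-1) t) := by
    rw [score_neg_one]
    exact measure_gumbel_le_add hσ (hε _) (hε _) (hind.indepFun (by simp)) _
  -- The scores for `z = -1` and `z = 1` differ by 1, so the score is a constant minus the indicator
  -- of choosing `W k`. That constant is the choice probability, hence the mean vanishes.
  have hform : ∀ ω, choiceScore μ u W Y ε σ k ω =
      score (-1) t - E.indicator (fun _ => (1 : ℝ)) ω := by
    intro ω
    by_cases h : ω ∈ E
    · have h' : EY + ε (k, 1) ω ≤ EW + ε (k, 0) ω := by
        have := h
        simp only [hE, Set.mem_ofPred_eq] at this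
        linarith
      have hc : choices μ u W Y ε ω k = 1 := if_pos h'
      rw [choiceScore, hc, Set.indicator_of_mem h, score_neg_one_eq, add_sub_cancel_right]
    · have h' : ¬ EY + ε (k, 1) ω ≤ EW + ε (k, 0) ω := by
        have := h
        simp only [hE, Set.mem_ofPred_eq] at this
        intro h2
        exact this (by linarith)
      have hc : choices μ u W Y ε ω k = -1 := if_neg h'
      rw [choiceScore, hc, Set.indicator_of_notMem h, sub_zero]
  have hfun : choiceScore μ u W Y ε σ k =
      fun ω => score (-1) t - E.indicator (fun _ => (1 : ℝ)) ω := funext hform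
  have hindm : AEMeasurable (E.indicator fun _ => (1 : ℝ)) μ :=
    aemeasurable_const.indicator₀ hEm
  have hpos : 0 ≤ score (-1) t := by
    rw [score_neg_one]
    positivity
  have hmean : ∫ ω, choiceScore μ u W Y ε σ k ω ∂μ = 0 := by
    rw [hfun, integral_sub (integrable_const _)
      ((integrable_const (1 : ℝ)).indicator₀ hEm), integral_indicator₀ hEm]
    simp [Measure.real, hμE, hpos]
  -- Hoeffding's lemma on an interval of length 1 gives the parameter `(1/2)² = 1/4`.
  have key := hasSubgaussianMGF_of_mem_Icc_of_integral_eq_zero (a := score (-1) t - 1)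
    (b := score (-1) t) (μ := μ) (X := choiceScore μ u W Y ε σ k)
    (by rw [hfun]; exact hindm.const_sub _)
    (ae_of_all _ fun ω => by
      rw [hform]
      by_cases h : ω ∈ E <;> simp [h]) hmean
  convert key using 1
  rw [sub_sub_cancel]
  norm_num

end Score

/-! ### Strong convexity of the logistic loss -/

section LogisticLoss

lemma omegaConst_pos (c : ℝ) : 0 < omegaConst c := by
  unfold omegaConst
  positivity

/-- The reciprocal of the right side is `2 + exp x + exp (-x)`, and each exponential is at most `exp
(2 * c)`. -/
lemma omegaConst_le_logistic_deriv {c x : ℝ} (hx : x ∈ Set.Icc (-c) c) :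
    omegaConst c ≤ Real.exp x / (1 + Real.exp x) ^ 2 := by
  have hc : 0 ≤ c := by linarith [hx.1, hx.2]
  have h1 : Real.exp x ≤ Real.exp (2 * c) := Real.exp_le_exp.2 (by linarith [hx.2])
  have h2 : Real.exp (-x) ≤ Real.exp (2 * c) := Real.exp_le_exp.2 (by linarith [hx.1])
  have h3 : Real.exp (-x) * Real.exp x = 1 := by rw [← Real.exp_add]; simp
  have hpos := Real.exp_pos x
  unfold omegaConst
  rw [div_le_div_iff₀ (by positivity) (by positivity)]
  nlinarith [mul_le_mul_of_nonneg_right h1 hpos.le, mul_le_mul_of_nonneg_right h2 hpos.le]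

lemma hasDerivAt_logistic_loss (x : ℝ) :
    HasDerivAt (fun x => Real.log (1 + Real.exp (-x))) (score 1 x) x := by
  have h1 : HasDerivAt (fun x : ℝ => 1 + Real.exp (-x)) (-Real.exp (-x)) x := by
    simpa using ((hasDerivAt_neg x).exp).const_add 1
  convert h1.log (by positivity) using 1
  have h : Real.exp (-x) * Real.exp x = 1 := by rw [← Real.exp_add]; simp
  unfold score
  rw [one_mul]
  field_simp
  linear_combination h

lemma hasDerivAt_score_one (x : ℝ) :
    HasDerivAt (score 1) (Real.exp x / (1 + Real.exp x) ^ 2) x := by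
  have h1 : HasDerivAt (fun x : ℝ => 1 + Real.exp x) (Real.exp x) x :=
    (Real.hasDerivAt_exp x).const_add 1
  have h2 := (h1.inv (by positivity)).neg
  have e : score 1 = -(fun x : ℝ => 1 + Real.exp x)⁻¹ := by
    funext z
    simp [score, neg_div]
  rw [e]
  convert! h2 using 1
  rw [neg_div, neg_neg]

lemma convexOn_logistic_loss_sub_sq (c : ℝ) :
    ConvexOn ℝ (Set.Icc (-c) c)
      (fun x => Real.log (1 + Real.exp (-x)) - omegaConst c / 2 * x ^ 2) := by
  have hd1 : ∀ x, HasDerivAt (fun x => Real.log (1 + Real.exp (-x)) - omegaConst c / 2 * x ^ 2)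
      (score 1 x - omegaConst c * x) x := fun x => by
    convert! (hasDerivAt_logistic_loss x).sub ((hasDerivAt_pow 2 x).const_mul (omegaConst c / 2))
      using 1
    push_cast
    ring
  have hd2 : ∀ x, HasDerivAt (fun x => score 1 x - omegaConst c * x)
      (Real.exp x / (1 + Real.exp x) ^ 2 - omegaConst c) x := fun x => by
    convert! (hasDerivAt_score_one x).sub ((hasDerivAt_id x).const_mul (omegaConst c)) using 1
    ring
  have e1 : deriv (fun x => Real.log (1 + Real.exp (-x)) - omegaConst c / 2 * x ^ 2) =
      fun x => score 1 x - omegaConst c * x := funext fun x => (hd1 x).deriv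
  refine convexOn_of_deriv2_nonneg' (convex_Icc _ _)
    (fun x _ => (hd1 x).differentiableAt.differentiableWithinAt) ?_ fun x hx => ?_
  · rw [e1]
    exact fun x _ => (hd2 x).differentiableAt.differentiableWithinAt
  · rw [Function.iterate_succ, Function.iterate_one, Function.comp_apply, e1, (hd2 x).deriv]
    linarith [omegaConst_le_logistic_deriv hx]

/-- A convex function lies above its tangents. -/
lemma tangent_le_of_convexOn {s : Set ℝ} {f : ℝ → ℝ} {f' x y : ℝ} (hf : ConvexOn ℝ s f)
    (hx : x ∈ s) (hy : y ∈ s) (hd : HasDerivAt f f' x) : f x + f' * (y - x) ≤ f y := by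
  rcases lt_trichotomy x y with h | h | h
  · have := hf.le_slope_of_hasDerivAt hx hy h hd
    rw [slope_def_field, le_div_iff₀ (by linarith)] at this
    linarith
  · simp [h]
  · have := hf.slope_le_of_hasDerivAt hy hx h hd
    rw [slope_def_field, div_le_iff₀ (by linarith)] at this
    linarith

/-- Subtracting `omegaConst c / 2 * x ^ 2` leaves a convex function, whose tangent inequality is
this bound. The case `z = -1` follows by reflecting `s` and `t`. -/
lemma logistic_loss_quadratic_lower_bound {c s t z : ℝ} (hz : z = 1 ∨ z = -1)
    (hs : s ∈ Set.Icc (-c) c) (ht : t ∈ Set.Icc (-c) c) :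
    Real.log (1 + Real.exp (-(z * t))) + score z t * (s - t) + omegaConst c / 2 * (s - t) ^ 2 ≤
      Real.log (1 + Real.exp (-(z * s))) := by
  have base : ∀ s ∈ Set.Icc (-c) c, ∀ t ∈ Set.Icc (-c) c,
      Real.log (1 + Real.exp (-t)) + score 1 t * (s - t) + omegaConst c / 2 * (s - t) ^ 2 ≤
        Real.log (1 + Real.exp (-s)) := by
    intro s hs t ht
    have h := tangent_le_of_convexOn (convexOn_logistic_loss_sub_sq c) ht hs
      ((hasDerivAt_logistic_loss t).sub ((hasDerivAt_pow 2 t).const_mul (omegaConst c / 2)))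
    push_cast at h
    linarith
  rcases hz with rfl | rfl
  · simpa using base s hs t ht
  · have h := base (-s) ⟨by linarith [hs.2], by linarith [hs.1]⟩ (-t)
      ⟨by linarith [ht.2], by linarith [ht.1]⟩
    have e : score (-1) t = -score 1 (-t) := by simp [score, neg_div]
    rw [e]
    simp only [neg_mul, one_mul]
    linarith

end LogisticLoss

/-! ### Smallest eigenvalue, rank and column space -/

section Eigenvalue

open Matrix

lemma minEigenvalue_mul_le {n : ℕ} {A : Matrix (Fin n) (Fin n) ℝ} (hA : A.IsHermitian)
    (x : Fin n → ℝ) : minEigenvalue A * ∑ i, x i ^ 2 ≤ x ⬝ᵥ (A *ᵥ x) := by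
  have hps : (A - algebraMap ℝ _ (minEigenvalue A)).PosSemidef := by
    rw [posSemidef_iff_isHermitian_and_spectrum_nonneg]
    refine ⟨hA.sub (by simp [IsHermitian, algebraMap_eq_diagonal]), ?_⟩
    rw [← spectrum.sub_singleton_eq]
    rintro _ ⟨a, ha, b, rfl, rfl⟩
    have hbdd : BddBelow (spectrum ℝ A) := by
      rw [hA.spectrum_real_eq_range_eigenvalues]
      exact (Set.finite_range _).bddBelow
    exact sub_nonneg.2 (csInf_le hbdd ha)
  have h := hps.dotProduct_mulVec_nonneg x
  rw [sub_mulVec, dotProduct_sub] at h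
  have e : star x ⬝ᵥ (algebraMap ℝ (Matrix (Fin n) (Fin n) ℝ) (minEigenvalue A) *ᵥ x) =
      minEigenvalue A * ∑ i, x i ^ 2 := by
    rw [Algebra.algebraMap_eq_smul_one, smul_mulVec, one_mulVec, dotProduct_smul, smul_eq_mul]
    simp [dotProduct, sq]
  rw [e] at h
  simpa using h

/-- The size is `n + 1` because an empty spectrum would have infimum `0`. -/
lemma minEigenvalue_pos {n : ℕ} {A : Matrix (Fin (n + 1)) (Fin (n + 1)) ℝ} (hA : A.PosDef) :
    0 < minEigenvalue A := by
  have hs := hA.isHermitian.spectrum_real_eq_range_eigenvalues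
  have hm : minEigenvalue A ∈ spectrum ℝ A := by
    refine Set.Nonempty.csInf_mem ?_ ?_
    · rw [hs]
      exact Set.range_nonempty _
    · rw [hs]
      exact Set.finite_range _
  rw [hs] at hm
  obtain ⟨i, hi⟩ := hm
  rw [← hi]
  exact hA.eigenvalues_pos i

variable {K m : ℕ}

lemma rank_infoMatrix (hK : 0 < K) (p : Fin K → Fin (m + 2) → ℝ) :
    (infoMatrix p).rank = (reducedMatrix p).rank := by
  have hK' : (1 / (K : ℝ)) ≠ 0 := by positivity
  rw [infoMatrix, rank_smul_of_mem_nonZeroDivisors _ (mem_nonZeroDivisors_of_ne_zero hK'),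
    rank_transpose_mul_self]

lemma dotProduct_regularized_infoMatrix (p : Fin K → Fin (m + 2) → ℝ) (lam : ℝ)
    (x : Fin (m + 1) → ℝ) :
    x ⬝ᵥ ((infoMatrix p + lam • (1 : Matrix (Fin (m + 1)) (Fin (m + 1)) ℝ)) *ᵥ x) =
      (∑ k, (reducedMatrix p *ᵥ x) k ^ 2) / K + lam * ∑ j, x j ^ 2 := by
  rw [add_mulVec, dotProduct_add, infoMatrix, smul_mulVec, smul_mulVec, one_mulVec,
    dotProduct_smul, dotProduct_smul, ← mulVec_mulVec, dotProduct_mulVec, vecMul_transpose]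
  simp only [dotProduct, smul_eq_mul, ← sq]
  ring

lemma isHermitian_regularized_infoMatrix (p : Fin K → Fin (m + 2) → ℝ) (lam : ℝ) :
    (infoMatrix p + lam • (1 : Matrix (Fin (m + 1)) (Fin (m + 1)) ℝ)).IsHermitian := by
  simp [IsHermitian, infoMatrix, conjTranspose_eq_transpose_of_trivial, transpose_mul]

lemma posDef_regularized_infoMatrix (p : Fin K → Fin (m + 2) → ℝ) {lam : ℝ} (hlam : 0 < lam) :
    (infoMatrix p + lam • (1 : Matrix (Fin (m + 1)) (Fin (m + 1)) ℝ)).PosDef := by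
  refine .of_dotProduct_mulVec_pos (isHermitian_regularized_infoMatrix p lam) fun x hx => ?_
  rw [star_trivial, dotProduct_regularized_infoMatrix]
  obtain ⟨j, hj⟩ := Function.ne_iff.1 hx
  have h1 : 0 < ∑ j, x j ^ 2 :=
    Finset.sum_pos' (fun _ _ => sq_nonneg _) ⟨j, Finset.mem_univ _, by have : x j ≠ 0 := hj; positivity⟩
  have h2 : 0 ≤ ∑ k, (reducedMatrix p *ᵥ x) k ^ 2 := Finset.sum_nonneg fun _ _ => sq_nonneg _
  positivity

/-- The column space of the reduced probability-mass difference matrix. -/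
noncomputable def columnSpace (p : Fin K → Fin (m + 2) → ℝ) :
    Submodule ℝ (EuclideanSpace ℝ (Fin K)) :=
  (LinearMap.range (reducedMatrix p).mulVecLin).map
    ((WithLp.linearEquiv 2 ℝ (Fin K → ℝ)).symm : (Fin K → ℝ) →ₗ[ℝ] EuclideanSpace ℝ (Fin K))

lemma finrank_columnSpace (hK : 0 < K) (p : Fin K → Fin (m + 2) → ℝ) :
    Module.finrank ℝ (columnSpace p) = (infoMatrix p).rank := by
  rw [rank_infoMatrix hK, columnSpace, LinearEquiv.finrank_map_eq]
  rfl

lemma toLp_mulVec_mem_columnSpace (p : Fin K → Fin (m + 2) → ℝ) (x : Fin (m + 1) → ℝ) :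
    WithLp.toLp 2 (reducedMatrix p *ᵥ x) ∈ columnSpace p :=
  Submodule.mem_map_of_mem ⟨x, rfl⟩

end Eigenvalue

/-! ### Expectations of lotteries as finite sums -/

section Lottery

variable {Ω : Type*} [MeasurableSpace Ω] {μ : Measure Ω} [IsProbabilityMeasure μ] {b : ℝ} {n : ℕ}

lemma integral_comp_lottery {X : Ω → ℝ} (hX : IsLottery μ b X) {y : Fin n → ℝ}
    (hy : Function.Injective y) (hs : atoms μ X ⊆ Set.range y) (f : ℝ → ℝ) :
    ∫ ω, f (X ω) ∂μ = ∑ j, μ.real (X ⁻¹' {y j}) * f (y j) := by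
  have hnm : ∀ j, NullMeasurableSet (X ⁻¹' {y j}) μ := fun j =>
    hX.aemeasurable.nullMeasurable (measurableSet_singleton _)
  have hae : ∀ᵐ ω ∂μ, f (X ω) = ∑ j, (X ⁻¹' {y j}).indicator (fun _ => f (y j)) ω := by
    filter_upwards [hX.ae_mem_support] with ω hω
    obtain ⟨i, hi⟩ := hs hω
    rw [Finset.sum_eq_single i]
    · simp [hi]
    · intro j _ hj
      refine Set.indicator_of_notMem (fun h => hj (hy ?_)) _
      rw [hi]
      exact (Set.mem_singleton_iff.1 h).symm
    · simp
  rw [integral_congr_ae hae,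
    integral_finsetSum _ fun j _ => (integrable_const _).indicator₀ (hnm j)]
  refine Finset.sum_congr rfl fun j _ => ?_
  rw [integral_indicator₀ (hnm j)]
  simp

lemma sum_mass_mul_mem_Icc {X : Ω → ℝ} (hX : IsLottery μ b X) {y : Fin n → ℝ}
    (hy : Function.Injective y) (hs : atoms μ X ⊆ Set.range y) {α : Fin n → ℝ} {γ : ℝ}
    (hα : ∀ j, α j ∈ Set.Icc 0 γ) :
    ∑ j, μ.real (X ⁻¹' {y j}) * α j ∈ Set.Icc 0 γ := by
  have htot : ∑ j, μ.real (X ⁻¹' {y j}) = 1 := by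
    simpa using (integral_comp_lottery hX hy hs fun _ => 1).symm
  refine ⟨Finset.sum_nonneg fun j _ => mul_nonneg measureReal_nonneg (hα j).1, ?_⟩
  calc ∑ j, μ.real (X ⁻¹' {y j}) * α j ≤ ∑ j, μ.real (X ⁻¹' {y j}) * γ :=
        Finset.sum_le_sum fun j _ => mul_le_mul_of_nonneg_left (hα j).2 measureReal_nonneg
    _ = γ := by rw [← Finset.sum_mul, htot, one_mul]

variable {K : ℕ} {W Y : Fin K → Ω → ℝ} {y : Fin n → ℝ}

/-- A difference of two averages of numbers in `[0, γ]`. With `γ ≤ c` this keeps the logits in the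
interval where the curvature bound is valid. -/
lemma sum_massDiff_mul_mem_Icc (hW : ∀ k, IsLottery μ b (W k)) (hY : ∀ k, IsLottery μ b (Y k))
    (hy : Function.Injective y) (hyS : Set.range y = breakpointSet μ b W Y)
    {α : Fin n → ℝ} {γ : ℝ} (hα : ∀ j, α j ∈ Set.Icc 0 γ) (k : Fin K) :
    ∑ j, massDiff μ W Y y k j * α j ∈ Set.Icc (-γ) γ := by
  have hWs : atoms μ (W k) ⊆ Set.range y := fun x hx => by
    rw [hyS]
    exact Or.inl (Or.inl (Or.inr (Set.mem_iUnion.2 ⟨k, hx⟩)))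
  have hYs : atoms μ (Y k) ⊆ Set.range y := fun x hx => by
    rw [hyS]
    exact Or.inl (Or.inr (Set.mem_iUnion.2 ⟨k, hx⟩))
  have h1 := sum_mass_mul_mem_Icc (hW k) hy hWs hα
  have h2 := sum_mass_mul_mem_Icc (hY k) hy hYs hα
  simp only [massDiff, sub_mul, Finset.sum_sub_distrib]
  exact ⟨by linarith [h1.1, h2.2], by linarith [h1.2, h2.1]⟩

lemma sum_massDiff_mul_div (hW : ∀ k, IsLottery μ b (W k)) (hY : ∀ k, IsLottery μ b (Y k))
    (hy : Function.Injective y) (hyS : Set.range y = breakpointSet μ b W Y)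
    (u : ℝ → ℝ) (σ : ℝ) (k : Fin K) :
    ∑ j, massDiff μ W Y y k j * (u (y j) / σ) =
      ((∫ ω, u (W k ω) ∂μ) - ∫ ω, u (Y k ω) ∂μ) / σ := by
  have hWs : atoms μ (W k) ⊆ Set.range y := fun x hx => by
    rw [hyS]
    exact Or.inl (Or.inl (Or.inr (Set.mem_iUnion.2 ⟨k, hx⟩)))
  have hYs : atoms μ (Y k) ⊆ Set.range y := fun x hx => by
    rw [hyS]
    exact Or.inl (Or.inr (Set.mem_iUnion.2 ⟨k, hx⟩))
  rw [integral_comp_lottery (hW k) hy hWs u, integral_comp_lottery (hY k) hy hYs u,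
    ← Finset.sum_sub_distrib, Finset.sum_div]
  refine Finset.sum_congr rfl fun j _ => ?_
  rw [massDiff]
  ring

end Lottery

/-! ### Endpoints of the grid -/

section Breakpoints

variable {Ω : Type*} [MeasurableSpace Ω] {μ : Measure Ω} {b : ℝ} {K m : ℕ}
  {W Y : Fin K → Ω → ℝ} {y : Fin (m + 2) → ℝ}

lemma breakpointSet_subset_Icc (hb : 0 < b) (hW : ∀ k, IsLottery μ b (W k))
    (hY : ∀ k, IsLottery μ b (Y k)) : breakpointSet μ b W Y ⊆ Set.Icc 0 b := by
  rintro x (((hx | hx) | hx) | hx)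
  · rw [Set.mem_singleton_iff.1 hx]
    exact ⟨le_rfl, hb.le⟩
  · obtain ⟨k, hk⟩ := Set.mem_iUnion.1 hx
    exact (hW k).support_subset hk
  · obtain ⟨k, hk⟩ := Set.mem_iUnion.1 hx
    exact (hY k).support_subset hk
  · rw [Set.mem_singleton_iff.1 hx]
    exact ⟨hb.le, le_rfl⟩

lemma breakpoint_endpoints (hb : 0 < b) (hW : ∀ k, IsLottery μ b (W k))
    (hY : ∀ k, IsLottery μ b (Y k)) (hy : StrictMono y)
    (hyS : Set.range y = breakpointSet μ b W Y) :
    y 0 = 0 ∧ y (Fin.last (m + 1)) = b := by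
  have hmem : ∀ j, y j ∈ Set.Icc 0 b := fun j =>
    breakpointSet_subset_Icc hb hW hY (hyS ▸ Set.mem_range_self j)
  have h0 : (0 : ℝ) ∈ Set.range y := by
    rw [hyS]
    exact Or.inl (Or.inl (Or.inl rfl))
  have h1 : b ∈ Set.range y := by
    rw [hyS]
    exact Or.inr rfl
  obtain ⟨i, hi⟩ := h0
  obtain ⟨j, hj⟩ := h1
  refine ⟨le_antisymm ?_ (hmem 0).1, le_antisymm (hmem _).2 ?_⟩
  · rw [← hi]
    exact hy.monotone (Fin.zero_le i)
  · rw [← hj]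
    exact hy.monotone (Fin.le_last j)

end Breakpoints

/-! ### Feasible points and interpolation -/

section Feasible

variable {m : ℕ} {L c b : ℝ} {y α : Fin (m + 2) → ℝ} {β : Fin (m + 1) → ℝ} {γ : ℝ}

lemma Feasible.slope_mem_Icc (h : Feasible L c y α β γ) (j : Fin (m + 1)) :
    β j ∈ Set.Icc 0 (L * γ) := by
  have hanti : Antitone β := Fin.antitone_iff_succ_le.2 h.concave
  exact ⟨h.monotone.trans (hanti (Fin.le_last j)), (hanti (Fin.zero_le j)).trans h.lipschitz⟩

lemma Feasible.value_succ (h : Feasible L c y α β γ) (hy : StrictMono y) (j : Fin (m + 1)) :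
    α j.succ = α j.castSucc + β j * (y j.succ - y j.castSucc) := by
  have hlt : 0 < y j.succ - y j.castSucc := sub_pos.2 (hy Fin.castSucc_lt_succ)
  rw [h.slope j, div_mul_cancel₀ _ hlt.ne']
  ring

lemma Feasible.value_mem_Icc (h : Feasible L c y α β γ) (hy : StrictMono y) (j : Fin (m + 2)) :
    α j ∈ Set.Icc 0 γ := by
  have hmono : Monotone α := Fin.monotone_iff_le_succ.2 fun i => by
    rw [h.value_succ hy]
    have := mul_nonneg (h.slope_mem_Icc i).1 (sub_pos.2 (hy (Fin.castSucc_lt_succ (i := i)))).le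
    linarith
  rw [← h.left_value, ← h.right_value]
  exact ⟨hmono (Fin.zero_le j), hmono (Fin.le_last j)⟩

lemma feasible_of_mem_utilityClass {u : ℝ → ℝ} (hu : u ∈ utilityClass b L) {σ : ℝ} (hc : 0 < c)
    (hσ : 1 / c ≤ σ) (hy : StrictMono y) (h0 : y 0 = 0) (h1 : y (Fin.last (m + 1)) = b) :
    Feasible L c y (fun j => u (y j) / σ)
      (fun j => (u (y j.succ) / σ - u (y j.castSucc) / σ) / (y j.succ - y j.castSucc)) (1 / σ) := by
  obtain ⟨hmono, hconc, hlip, hu0, hu1⟩ := hu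
  have hσ0 : 0 < σ := lt_of_lt_of_le (by positivity) hσ
  have hmem : ∀ j, y j ∈ Set.Icc 0 b := fun j => by
    rw [← h0, ← h1]
    exact ⟨hy.monotone (Fin.zero_le j), hy.monotone (Fin.le_last j)⟩
  have hlt : ∀ j : Fin (m + 1), 0 < y j.succ - y j.castSucc := fun j =>
    sub_pos.2 (hy Fin.castSucc_lt_succ)
  have hslope : ∀ j : Fin (m + 1),
      (u (y j.succ) / σ - u (y j.castSucc) / σ) / (y j.succ - y j.castSucc) =
        (u (y j.succ) - u (y j.castSucc)) / (y j.succ - y j.castSucc) / σ := fun j => by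
    rw [← sub_div, div_right_comm]
  constructor
  · exact fun j => rfl
  · intro j
    rw [hslope, hslope]
    refine div_le_div_of_nonneg_right ?_ hσ0.le
    have := hconc.slope_anti_adjacent (hmem j.castSucc.castSucc) (hmem j.succ.succ)
      (y := y j.succ.castSucc) (by rw [← Fin.succ_castSucc]; exact hy Fin.castSucc_lt_succ)
      (hy Fin.castSucc_lt_succ)
    rw [Fin.succ_castSucc]
    exact this
  · rw [hslope, mul_one_div]
    refine div_le_div_of_nonneg_right ?_ hσ0.le
    rw [div_le_iff₀ (hlt 0)]
    have := hlip _ (hmem (Fin.succ 0)) _ (hmem (Fin.castSucc 0))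
    rw [abs_of_pos (hlt 0)] at this
    exact (le_abs_self _).trans this
  · rw [hslope]
    refine div_nonneg (div_nonneg (sub_nonneg.2 ?_) (hlt _).le) hσ0.le
    exact hmono (hmem _) (hmem _) (sub_pos.1 (hlt _)).le
  · simp [h0, hu0]
  · simp [h1, hu1]
  · refine ⟨by positivity, ?_⟩
    rw [div_le_iff₀ hσ0]
    rwa [div_le_iff₀ hc, mul_comm] at hσ

lemma exists_subinterval {t : ℝ} (ht0 : y 0 ≤ t) (ht1 : t < y (Fin.last (m + 1))) :
    ∃ j : Fin (m + 1), y j.castSucc ≤ t ∧ t < y j.succ := by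
  by_contra! hcon
  have hall : ∀ i, y i ≤ t := fun i =>
    Fin.induction (motive := fun i => y i ≤ t) ht0 (fun j hj => hcon j hj) i
  exact (hall _).not_gt ht1

/-- The scaling by `γ` cancels, and the prescribed endpoint values agree with the linear pieces. For
`γ = 0` all values and slopes vanish, which matches the convention. -/
lemma adjustedMLE_eq (h : Feasible L c y α β γ) (hy : StrictMono y) {t : ℝ}
    (ht : t ∈ Set.Icc (y 0) (y (Fin.last (m + 1)))) :
    ∃ j : Fin (m + 1), t ∈ Set.Icc (y j.castSucc) (y j.succ) ∧
      adjustedMLE y α β γ t = α j.castSucc + β j * (t - y j.castSucc) := by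
  by_cases hγ : γ = 0
  · have hα : ∀ j, α j = 0 := fun j => by simpa [hγ] using h.value_mem_Icc hy j
    have hβ : ∀ j, β j = 0 := fun j => by simpa [hγ] using h.slope_mem_Icc j
    have hex : ∃ j : Fin (m + 1), t ∈ Set.Icc (y j.castSucc) (y j.succ) := by
      rcases ht.2.eq_or_lt with h1 | h1
      · refine ⟨Fin.last m, ?_, ?_⟩
        · rw [h1]
          exact hy.monotone (Fin.le_last _)
        · rw [h1, Fin.succ_last]
      · obtain ⟨j, hj⟩ := exists_subinterval ht.1 h1
        exact ⟨j, hj.1, hj.2.le⟩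
    obtain ⟨j, hj⟩ := hex
    exact ⟨j, hj, by simp [adjustedMLE, hγ, hα, hβ]⟩
  · rw [adjustedMLE, if_neg hγ, uMLE, piecewiseLinear, sigmaMLE, div_div_eq_mul_div, div_one]
    by_cases h0 : t = y 0
    · refine ⟨0, ⟨h0.ge, ?_⟩, ?_⟩
      · rw [h0]
        exact hy.monotone (Fin.zero_le _)
      · rw [if_pos h0, Fin.castSucc_zero, h.left_value, h0]
        ring
    · rw [if_neg h0]
      by_cases h1 : t = y (Fin.last (m + 1))
      · refine ⟨Fin.last m, ⟨?_, ?_⟩, ?_⟩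
        · rw [h1]
          exact hy.monotone (Fin.le_last _)
        · rw [h1, Fin.succ_last]
        · rw [if_pos h1, h1, ← Fin.succ_last, ← h.value_succ hy, Fin.succ_last, h.right_value,
            one_mul]
      · obtain ⟨j, hj⟩ := exists_subinterval ht.1 (lt_of_le_of_ne ht.2 h1)
        refine ⟨j, ⟨hj.1, hj.2.le⟩, ?_⟩
        rw [if_neg h1, Finset.sum_eq_single j]
        · rw [if_pos hj]
          field_simp
          ring
        · intro i _ hij
          refine if_neg fun hi => hij ?_
          have h2 := hy.lt_iff_lt.1 (hi.1.trans_lt hj.2)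
          have h3 := hy.lt_iff_lt.1 (hj.1.trans_lt hi.2)
          rw [Fin.castSucc_lt_succ_iff] at h2 h3
          exact le_antisymm h2 h3
        · simp

lemma sub_le_mesh (j : Fin (m + 1)) : y j.succ - y j.castSucc ≤ mesh y :=
  Finset.le_sup' (fun j : Fin (m + 1) => y j.succ - y j.castSucc) (Finset.mem_univ j)

lemma kolmogorovDist_adjustedMLE_le {u : ℝ → ℝ} (hu : u ∈ utilityClass b L) {σ : ℝ} (hc : 0 < c)
    (hL : 0 < L) (hσ : 1 / c ≤ σ) (hy : StrictMono y) (h0 : y 0 = 0)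
    (h1 : y (Fin.last (m + 1)) = b) (h : Feasible L c y α β γ) {D : ℝ}
    (hD : ∀ j, |α j - u (y j) / σ| ≤ D) :
    kolmogorovDist (y 0) (y (Fin.last (m + 1))) (adjustedMLE y α β γ) (fun t => u t / σ) ≤
      ENNReal.ofReal (L * c * mesh y + D) := by
  refine iSup₂_le fun t ht => ENNReal.ofReal_le_ofReal ?_
  obtain ⟨hmono, -, hlip, -⟩ := hu
  have hσ0 : 0 < σ := lt_of_lt_of_le (by positivity) hσ
  have hσc : 1 / σ ≤ c := by
    rw [div_le_iff₀ hσ0]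
    rwa [div_le_iff₀ hc, mul_comm] at hσ
  obtain ⟨j, hj, hval⟩ := adjustedMLE_eq h hy ht
  have hmem : y j.castSucc ∈ Set.Icc 0 b := by
    rw [← h0, ← h1]
    exact ⟨hy.monotone (Fin.zero_le _), hy.monotone (Fin.le_last _)⟩
  have htm : t ∈ Set.Icc 0 b := by rwa [← h0, ← h1]
  have hstep : t - y j.castSucc ≤ mesh y := by linarith [sub_le_mesh (y := y) j, hj.2]
  have hstep0 : 0 ≤ t - y j.castSucc := sub_nonneg.2 hj.1
  have hmesh0 : 0 ≤ mesh y := hstep0.trans hstep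
  have hβ := h.slope_mem_Icc j
  have hβc : β j ≤ L * c := hβ.2.trans (mul_le_mul_of_nonneg_left h.gamma_mem.2 hL.le)
  have e1 : 0 ≤ β j * (t - y j.castSucc) := mul_nonneg hβ.1 hstep0
  have e2 : β j * (t - y j.castSucc) ≤ L * c * mesh y :=
    mul_le_mul hβc hstep hstep0 (by positivity)
  have e3 : u (y j.castSucc) / σ ≤ u t / σ :=
    div_le_div_of_nonneg_right (hmono hmem htm hj.1) hσ0.le
  have e4 : u t / σ - u (y j.castSucc) / σ ≤ L * c * mesh y := by
    have hl := (le_abs_self _).trans (hlip _ htm _ hmem)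
    rw [abs_of_nonneg hstep0] at hl
    calc u t / σ - u (y j.castSucc) / σ = 1 / σ * (u t - u (y j.castSucc)) := by ring
      _ ≤ 1 / σ * (L * (t - y j.castSucc)) := mul_le_mul_of_nonneg_left hl (by positivity)
      _ ≤ c * (L * mesh y) := by gcongr
      _ = L * c * mesh y := by ring
  -- Both functions increase from `y j.castSucc` to `t` by an amount in `[0, L * c * mesh y]`, so
  -- the increments differ by one such term and not two.
  have hDj := abs_le.1 (hD j.castSucc)
  rw [hval, abs_le]
  constructor <;> linarith [hDj.1, hDj.2]

end Feasible

/-! ### From the score bound to the coefficient error -/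

section EstimationError

open Matrix

variable {K m : ℕ} {L c : ℝ} {y α α₀ : Fin (m + 2) → ℝ} {β β₀ : Fin (m + 1) → ℝ} {γ γ₀ : ℝ}
  {p : Fin K → Fin (m + 2) → ℝ} {Z : Fin K → ℝ}

/-- The basic inequality of maximum likelihood: the prediction error of an optimal solution is
controlled by the projection of the score vector to the column space. -/
lemma IsOptimal.norm_prediction_error_le (h : IsOptimal L c y p Z α β γ)
    (h₀ : Feasible L c y α₀ β₀ γ₀) (hZ : ∀ k, Z k = 1 ∨ Z k = -1)
    (hα : ∀ k, ∑ j, p k j * α j ∈ Set.Icc (-c) c)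
    (hα₀ : ∀ k, ∑ j, p k j * α₀ j ∈ Set.Icc (-c) c) :
    omegaConst c *
        ‖WithLp.toLp 2 (reducedMatrix p *ᵥ fun j : Fin (m + 1) => α j.succ - α₀ j.succ)‖ ≤
      2 * ‖(columnSpace p).starProjection
        (WithLp.toLp 2 fun k => score (Z k) (∑ j, p k j * α₀ j))‖ := by
  set x : Fin (m + 1) → ℝ := fun j => α j.succ - α₀ j.succ
  set d : EuclideanSpace ℝ (Fin K) := WithLp.toLp 2 (reducedMatrix p *ᵥ x) with hd
  set v : EuclideanSpace ℝ (Fin K) := WithLp.toLp 2 fun k => score (Z k) (∑ j, p k j * α₀ j)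
  -- The first column of `p` may be dropped because both vectors vanish at index `0`.
  have hdk : ∀ k, d k = ∑ j, p k j * α j - ∑ j, p k j * α₀ j := by
    intro k
    rw [← Finset.sum_sub_distrib, Fin.sum_univ_succ, h.1.left_value, h₀.left_value]
    simp [hd, x, mulVec, dotProduct, reducedMatrix, mul_sub]
  have hlik : ∀ a : Fin (m + 2) → ℝ, logLikelihood p Z a =
      -∑ k, Real.log (1 + Real.exp (-(Z k * ∑ j, p k j * a j))) := by
    intro a
    simp only [logLikelihood, Finset.mul_sum, ← Finset.sum_neg_distrib, neg_mul, mul_assoc]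
  have hopt := h.2 α₀ β₀ γ₀ h₀
  rw [hlik, hlik, neg_le_neg_iff] at hopt
  have hlow : ∑ k, (Real.log (1 + Real.exp (-(Z k * ∑ j, p k j * α₀ j))) + v k * d k +
      omegaConst c / 2 * d k ^ 2) ≤
      ∑ k, Real.log (1 + Real.exp (-(Z k * ∑ j, p k j * α j))) := by
    refine Finset.sum_le_sum fun k _ => ?_
    rw [hdk]
    exact logistic_loss_quadratic_lower_bound (hZ k) (hα k) (hα₀ k)
  rw [Finset.sum_add_distrib, Finset.sum_add_distrib, ← Finset.mul_sum] at hlow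
  have hnorm : ∑ k, d k ^ 2 = ‖d‖ ^ 2 := by simp [EuclideanSpace.norm_sq_eq]
  have hinner : ∑ k, v k * d k = inner ℝ ((columnSpace p).starProjection v) d := by
    rw [(columnSpace p).inner_starProjection_left_eq_right,
      Submodule.starProjection_eq_self_iff.2 (toLp_mulVec_mem_columnSpace p x), PiLp.inner_apply]
    exact Finset.sum_congr rfl fun k _ => mul_comm _ _
  have hcs := (abs_le.1 (abs_real_inner_le_norm ((columnSpace p).starProjection v) d)).1
  rw [hnorm, hinner] at hlow
  rcases (norm_nonneg d).eq_or_lt with h0 | h0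
  · rw [← h0, mul_zero]
    positivity
  · refine le_of_mul_le_mul_right ?_ h0
    nlinarith

variable {lam δ : ℝ}

lemma noiseTerm_mul (c δ : ℝ) (hK : 0 < K) (p : Fin K → Fin (m + 2) → ℝ) :
    noiseTerm c δ p * (omegaConst c ^ 2 * K) =
      ((infoMatrix p).rank : ℝ) + 2 * √(-((infoMatrix p).rank : ℝ) * Real.log δ)
        - 2 * Real.log δ := by
  have := omegaConst_pos c
  have hK' : (0 : ℝ) < K := by exact_mod_cast hK
  exact div_mul_cancel₀ _ (by positivity)

lemma noiseTerm_nonneg (c : ℝ) (hδ0 : 0 < δ) (hδ1 : δ < 1) (p : Fin K → Fin (m + 2) → ℝ) :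
    0 ≤ noiseTerm c δ p := by
  have hlog := Real.log_neg hδ0 hδ1
  have := omegaConst_pos c
  refine div_nonneg ?_ (by positivity)
  have : 0 ≤ 2 * √(-((infoMatrix p).rank : ℝ) * Real.log δ) := by positivity
  have : (0 : ℝ) ≤ (infoMatrix p).rank := Nat.cast_nonneg _
  linarith

lemma estimationBound_nonneg (c lam δ : ℝ) (p : Fin K → Fin (m + 2) → ℝ) :
    0 ≤ estimationBound c lam δ p := by
  unfold estimationBound
  positivity

/-- If the projected score vector is small, then every optimal solution is close to the truth. -/
lemma IsOptimal.abs_sub_le_estimationBound (h : IsOptimal L c y p Z α β γ)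
    (h₀ : Feasible L c y α₀ β₀ γ₀) (hy : StrictMono y) (hK : 0 < K)
    (hZ : ∀ k, Z k = 1 ∨ Z k = -1) (hα : ∀ k, ∑ j, p k j * α j ∈ Set.Icc (-c) c)
    (hα₀ : ∀ k, ∑ j, p k j * α₀ j ∈ Set.Icc (-c) c)
    (hlam : 0 < lam) (hδ0 : 0 < δ) (hδ1 : δ < 1)
    (hscore : ‖(columnSpace p).starProjection
        (WithLp.toLp 2 fun k => score (Z k) (∑ j, p k j * α₀ j))‖ ^ 2 ≤
      (Module.finrank ℝ (columnSpace p) : ℝ) + 2 * (-Real.log δ)) (i : Fin (m + 2)) :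
    |α i - α₀ i| ≤ estimationBound c lam δ p := by
  set x : Fin (m + 1) → ℝ := fun j => α j.succ - α₀ j.succ with hx
  set n := noiseTerm c δ p
  have hn : 0 ≤ n := noiseTerm_nonneg c hδ0 hδ1 p
  have hK' : (0 : ℝ) < K := by exact_mod_cast hK
  have hω := omegaConst_pos c
  have hpred := h.norm_prediction_error_le h₀ hZ hα hα₀
  have hnorm : ∑ k, (reducedMatrix p *ᵥ x) k ^ 2 =
      ‖WithLp.toLp 2 (reducedMatrix p *ᵥ x)‖ ^ 2 := by simp [EuclideanSpace.norm_sq_eq]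
  have hd : (∑ k, (reducedMatrix p *ᵥ x) k ^ 2) / K ≤ 4 * n := by
    rw [finrank_columnSpace hK] at hscore
    have h2 := noiseTerm_mul c δ hK p
    -- The tail bound has no square-root cross term; the one in `noiseTerm` is slack, and only its
    -- sign is used.
    have h3 : 0 ≤ √(-((infoMatrix p).rank : ℝ) * Real.log δ) := Real.sqrt_nonneg _
    have h4 := pow_le_pow_left₀ (by positivity) hpred 2
    rw [mul_pow, mul_pow, ← hnorm] at h4
    rw [div_le_iff₀ hK']
    refine le_of_mul_le_mul_left ?_ (pow_pos hω 2)
    linarith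
  -- Both values lie in `[0, c]`, so their difference is at most `c` in absolute value, not `2 * c`.
  have hx1 : ∀ j, x j ^ 2 ≤ c ^ 2 := by
    intro j
    have e1 := h.1.value_mem_Icc hy j.succ
    have e2 := h₀.value_mem_Icc hy j.succ
    refine sq_le_sq' ?_ ?_ <;> simp only [hx] <;>
      linarith [e1.1, e1.2, e2.1, e2.2, h.1.gamma_mem.2, h₀.gamma_mem.2]
  have hxs : ∑ j, x j ^ 2 ≤ (c * √((m : ℝ) + 1)) ^ 2 := by
    rw [mul_pow, Real.sq_sqrt (by positivity)]
    calc ∑ j, x j ^ 2 ≤ ∑ _j : Fin (m + 1), c ^ 2 := Finset.sum_le_sum fun j _ => hx1 j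
      _ = c ^ 2 * ((m : ℝ) + 1) := by
        simp
        ring
  set A := infoMatrix p + lam • (1 : Matrix (Fin (m + 1)) (Fin (m + 1)) ℝ) with hA
  have hmin := minEigenvalue_pos (posDef_regularized_infoMatrix p hlam)
  have heig := minEigenvalue_mul_le (isHermitian_regularized_infoMatrix p lam) x
  rw [dotProduct_regularized_infoMatrix, ← hA] at heig
  rw [← hA] at hmin
  set B := lam * (c * √((m : ℝ) + 1)) ^ 2
  have hB0 : 0 ≤ B := by positivity
  have hlamx : lam * ∑ j, x j ^ 2 ≤ B := mul_le_mul_of_nonneg_left hxs hlam.le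
  -- The square is `2 * n + B + 2 * √n * √(n + B)`, and the cross term is at least `2 * n`.
  have hsq : 4 * n + B ≤ (√n + √(n + B)) ^ 2 := by
    have e1 : √n ≤ √(n + B) := Real.sqrt_le_sqrt (by linarith)
    have e2 := Real.sq_sqrt hn
    have e3 := Real.sq_sqrt (add_nonneg hn hB0)
    nlinarith [Real.sqrt_nonneg n, Real.sqrt_nonneg (n + B)]
  refine Fin.cases ?_ (fun j => ?_) i
  · rw [h.1.left_value, h₀.left_value, sub_zero, abs_zero]
    exact estimationBound_nonneg _ _ _ _
  · rw [estimationBound, le_div_iff₀ (Real.sqrt_pos.2 hmin)]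
    refine abs_le_of_sq_le_sq' ?_ (by positivity) |>.2
    rw [mul_pow, Real.sq_sqrt hmin.le, sq_abs]
    have hj : x j ^ 2 ≤ ∑ j, x j ^ 2 :=
      Finset.single_le_sum (f := fun j => x j ^ 2) (fun _ _ => sq_nonneg _) (Finset.mem_univ j)
    calc (α j.succ - α₀ j.succ) ^ 2 * minEigenvalue A
        = minEigenvalue A * x j ^ 2 := mul_comm _ _
      _ ≤ minEigenvalue A * ∑ j, x j ^ 2 := mul_le_mul_of_nonneg_left hj hmin.le
      _ ≤ 4 * n + B := by linarith
      _ ≤ _ := hsq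

end EstimationError

end PrefElicit

theorem mainTheorem2 {Ω : Type*} [MeasurableSpace Ω] (μ : Measure Ω) [IsProbabilityMeasure μ]
    (b L c : ℝ) (hb : 0 < b) (hL : 0 < L) (hc : 0 < c)
    (uStar : ℝ → ℝ) (hu : uStar ∈ PrefElicit.utilityClass b L)
    (σStar : ℝ) (hσ : 1 / c ≤ σStar)
    (K : ℕ) (hK : 0 < K) (W Y : Fin K → Ω → ℝ)
    (hW : ∀ k, PrefElicit.IsLottery μ b (W k)) (hY : ∀ k, PrefElicit.IsLottery μ b (Y k))
    (m : ℕ) (y : Fin (m + 2) → ℝ) (hy : StrictMono y)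
    (hyS : Set.range y = PrefElicit.breakpointSet μ b W Y)
    (ε : Fin K × Fin 2 → Ω → ℝ)
    (hεlaw : ∀ i, HasLaw (ε i) (PrefElicit.gumbelMeasure σStar) μ)
    (hεind : iIndepFun ε μ)
    (lam δ : ℝ) (hlam : 0 < lam) (hδ0 : 0 < δ) (hδ1 : δ < 1) :
    ENNReal.ofReal (1 - δ) ≤
      μ {ω | ∀ (α : Fin (m + 2) → ℝ) (β : Fin (m + 1) → ℝ) (γ : ℝ),
        PrefElicit.IsOptimal L c y (PrefElicit.massDiff μ W Y y)
          (PrefElicit.choices μ uStar W Y ε ω) α β γ →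
        PrefElicit.kolmogorovDist (y 0) (y (Fin.last (m + 1)))
            (PrefElicit.adjustedMLE y α β γ) (fun t => uStar t / σStar) ≤
          ENNReal.ofReal (L * c * PrefElicit.mesh y +
            PrefElicit.estimationBound c lam δ (PrefElicit.massDiff μ W Y y))} := by
  open PrefElicit in
  have hσ0 : 0 < σStar := lt_of_lt_of_le (by positivity) hσ
  obtain ⟨hy0, hy1⟩ := breakpoint_endpoints hb hW hY hy hyS
  have h₀ := feasible_of_mem_utilityClass hu hc hσ hy hy0 hy1
  have hrange : ∀ {α β γ}, Feasible L c y α β γ →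
      ∀ k, ∑ j, massDiff μ W Y y k j * α j ∈ Set.Icc (-c) c := fun h k =>
    Set.Icc_subset_Icc (neg_le_neg h.gamma_mem.2) h.gamma_mem.2
      (sum_massDiff_mul_mem_Icc hW hY hy.injective hyS (h.value_mem_Icc hy) k)
  set bad : Set Ω := {ω | (Module.finrank ℝ (columnSpace (massDiff μ W Y y)) : ℝ) +
      2 * (-Real.log δ) < ‖(columnSpace (massDiff μ W Y y)).starProjection
        (WithLp.toLp 2 fun k => choiceScore μ uStar W Y ε σStar k ω)‖ ^ 2}
  have hbad : μ bad ≤ ENNReal.ofReal δ := by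
    have := measure_norm_starProjection_sq_le (choiceScore μ uStar W Y ε σStar)
      (iIndepFun_choiceScore (fun i => (hεlaw i).aemeasurable) hεind)
      (hasSubgaussianMGF_choiceScore hσ0 hεlaw hεind) (columnSpace (massDiff μ W Y y))
      (-Real.log δ)
    rwa [neg_neg, Real.exp_log hδ0] at this
  -- Subadditivity suffices here, so `bad` need not be shown measurable.
  have hgood : ENNReal.ofReal (1 - δ) ≤ μ badᶜ := by
    rw [ENNReal.ofReal_sub _ hδ0.le, ENNReal.ofReal_one, tsub_le_iff_right]
    calc 1 = μ (badᶜ ∪ bad) := by rw [Set.compl_union_self, measure_univ]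
      _ ≤ μ badᶜ + μ bad := measure_union_le _ _
      _ ≤ μ badᶜ + ENNReal.ofReal δ := by gcongr
  refine hgood.trans (measure_mono fun ω hω α β γ hopt => ?_)
  refine kolmogorovDist_adjustedMLE_le hu hc hL hσ hy hy0 hy1 hopt.1
    (hopt.abs_sub_le_estimationBound h₀ hy hK (fun k => ?_) (hrange hopt.1) (hrange h₀)
      hlam hδ0 hδ1 ?_)
  · unfold choices
    split_ifs
    · exact Or.inl rfl
    · exact Or.inr rfl
  · simp_rw [sum_massDiff_mul_div hW hY hy.injective hyS]
    exact not_lt.1 hω
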